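/- Let $n$ be a positive integer and let $\mathbf b=(b_1,\dots,b_n)$ be a vector of positive integers; exclude the degenerate case $n=1=b_1$. A $\mathbf b$-parking function is a list $(\beta_1,\dots,\beta_n)$ of positive integers whose nondecreasing rearrangement $\beta'_1\le\cdots\le\beta'_n$ satisfies $\beta'_i\le b_1+\cdots+b_i$ for all $1\le i\le n$. Let $\mathfrak X_n(\mathbf b)\subset\mathbb R^n$ be the convex hull of all $\mathbf b$-parking functions. For $k=0,1,\dots,n$, let $f_k$ be the number of $k$-dimensional faces of $\mathfrak X_n(\mathbf b)$ (the polytope itself counts as a face). Then $$ f_k=\begin{cases} \displaystyle\sum_{\substack{0\le j\le n-k\\ j\ne 1}}\binom nj\,(n-k-j)!\;S(n-j+1,\,n-k-j+1) & \text{if } b_1=1,\\[3ex] \displaystyle\sum_{j=0}^{n-k}\binom nj\,(n-k-j)!\;S(n-j+1,\,n-k-j+1) & \text{if } b_1\ge 2, \end{cases} $$ where $S(m,l)$ is the Stirling number of the second kind, that is, the number of partitions of an $m$-element set into $l$ nonempty blocks. -/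

import Mathlib

/-- `β` is a `b`-parking function of length `n`: a list of positive integers whose nondecreasing
rearrangement `β ∘ Tuple.sort β` is bounded entrywise by the partial sums of `b`. -/
def IsParkingFunction {n : ℕ} (b β : Fin n → ℕ) : Prop :=
  (∀ i, 0 < β i) ∧ ∀ i, (β ∘ Tuple.sort β) i ≤ ∑ j ∈ Finset.Iic i, b j

/-- The `b`-parking-function polytope in `ℝⁿ`. -/
def parkingPolytope {n : ℕ} (b : Fin n → ℕ) : Set (Fin n → ℝ) :=
  convexHull ℝ {x | ∃ β : Fin n → ℕ, IsParkingFunction b β ∧ x = fun i => (β i : ℝ)}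

/-- The `k`-dimensional faces of a polytope `P`: the nonempty subsets of `P` that are the locus where
some linear functional attains its maximum over `P` (the zero functional gives `P` itself), and whose
affine span has dimension `k`. -/
def facesOfDim {n : ℕ} (P : Set (Fin n → ℝ)) (k : ℕ) : Set (Set (Fin n → ℝ)) :=
  {F | F.Nonempty ∧ IsExposed ℝ P F ∧ Module.finrank ℝ (vectorSpan ℝ F) = k}

/-- The number of `k`-dimensional faces, as an extended natural number. -/
noncomputable def faceNumber {n : ℕ} (P : Set (Fin n → ℝ)) (k : ℕ) : ℕ∞ :=
  (facesOfDim P k).encard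

/-! Let `B` be the strictly increasing sequence of partial sums. Parking functions are the lattice
points of the union over `σ` of the boxes `1 ≤ β ∘ σ ≤ B`. By the rearrangement inequality, `c` is
maximized by sorting the coordinates by the positive part of `c`, filling the places where `c > 0`
up to `B`, and putting `1` where `c < 0` (`isOptimal_iff`). So a face depends only on the signs of
`c` and the order of its positive parts, and `c` may be replaced by a map `ρ` onto levels `1, …, r`,
with `0` and `-1` also allowed (`exists_isLevelMap`).

Distinct `ρ` give distinct faces, with one exception: if `B` takes the value `1` and `ρ` has a
single nonpositive coordinate, that coordinate is forced to be `1` and could as well form a level of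
its own. Discarding these `ρ` leaves a bijection with the faces (`IsLevelMap.eq_of_isOptimal_iff`,
`IsLevelMap.exists_isReduced`). The functionals constant on the face vanish where `ρ = 0` and are
constant on each positive level, so its codimension is `r` plus the number `j` of negative
coordinates (`IsReducedMap.finrank_vectorSpan`).

For given `j` and `r` there are `(n choose j) * r! * S(n - j + 1, r + 1)` maps (`card_levelFinset`).
When `b_1 = 1`, a shift by one turns the condition "not exactly one nonpositive value" into "not
exactly one negative value", which is the condition `j ≠ 1`. -/

/-- The partial sums `b 0 + ⋯ + b k`. -/
def prefixSum {n : ℕ} (b : Fin n → ℕ) (k : Fin n) : ℕ := ∑ j ∈ Finset.Iic k, b j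

lemma prefixSum_strictMono {n : ℕ} {b : Fin n → ℕ} (hb : ∀ i, 0 < b i) :
    StrictMono (prefixSum b) := by
  intro i j hij
  refine Finset.sum_lt_sum_of_subset (i := j) (Finset.Iic_subset_Iic.2 hij.le) ?_ ?_ (hb j) ?_
  · simp
  · simpa using hij
  · intros; exact Nat.zero_le _

lemma prefixSum_pos {n : ℕ} {b : Fin n → ℕ} (hb : ∀ i, 0 < b i) (k : Fin n) :
    0 < prefixSum b k :=
  (hb k).trans_le (Finset.single_le_sum (f := b) (fun _ _ => Nat.zero_le _) (by simp))

lemma prefixSum_zero {n : ℕ} (hn : 0 < n) (b : Fin n → ℕ) :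
    prefixSum b ⟨0, hn⟩ = b ⟨0, hn⟩ := by
  have : Finset.Iic (⟨0, hn⟩ : Fin n) = {⟨0, hn⟩} := by
    ext i; simp [Fin.le_def, Fin.ext_iff]
  simp [prefixSum, this]

/-- A list of positive integers is a parking function iff some rearrangement of it is bounded
entrywise by the partial sums. -/
lemma isParkingFunction_iff {n : ℕ} {b : Fin n → ℕ} (hb : ∀ i, 0 < b i) {β : Fin n → ℕ} :
    IsParkingFunction b β ↔
      (∀ i, 0 < β i) ∧ ∃ σ : Equiv.Perm (Fin n), ∀ k, β (σ k) ≤ prefixSum b k := by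
  refine and_congr_right fun _ => ⟨fun h => ⟨Tuple.sort β, h⟩, ?_⟩
  rintro ⟨σ, hσ⟩ i
  change _ ≤ prefixSum b i
  -- The sorted bound at `i` says that more than `i` entries are at most `prefixSum b i`, a count
  -- that no rearrangement changes.
  rw [← Tuple.lt_card_le_iff_apply_le_of_monotone (Tuple.monotone_sort β)]
  have h1 : Finset.card {j | (β ∘ Tuple.sort β) j ≤ prefixSum b i} =
      Finset.card {j | β (σ j) ≤ prefixSum b i} :=
    Finset.card_equiv ((Tuple.sort β).trans σ.symm) fun j => by simp
  rw [h1]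
  have h2 : Finset.Iic i ⊆ Finset.univ.filter fun j => β (σ j) ≤ prefixSum b i := fun j hj => by
    simpa using (hσ j).trans ((prefixSum_strictMono hb).monotone (Finset.mem_Iic.1 hj))
  have h3 := Finset.card_le_card h2
  rw [Fin.card_Iic] at h3
  omega

/-! ### Maximizing a linear functional over the lattice points -/

/-- The points of `⋃ σ, {β | 1 ≤ β ∘ σ ≤ B}` that turn out to be the maximizers of `c`. -/
def IsOptimal {n : ℕ} {R : Type*} [LinearOrder R] [Zero R] (B : Fin n → ℕ) (c : Fin n → R)
    (β : Fin n → ℕ) : Prop :=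
  ∃ σ : Equiv.Perm (Fin n), Monotone (fun k => max (c (σ k)) 0) ∧
    ∀ k, 0 < β (σ k) ∧ β (σ k) ≤ B k ∧ (0 < c (σ k) → β (σ k) = B k) ∧
      (c (σ k) < 0 → β (σ k) = 1)

lemma isOptimal_congr {n : ℕ} {R S : Type*} [LinearOrder R] [Zero R] [LinearOrder S] [Zero S]
    {B : Fin n → ℕ} {c : Fin n → R} {d : Fin n → S} (hneg : ∀ i, c i < 0 ↔ d i < 0)
    (hpos : ∀ i, 0 < c i ↔ 0 < d i)
    (hle : ∀ i j, max (c i) 0 ≤ max (c j) 0 ↔ max (d i) 0 ≤ max (d j) 0) {β : Fin n → ℕ} :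
    IsOptimal B c β ↔ IsOptimal B d β := by
  simp only [IsOptimal, hneg, hpos, Monotone, hle]

/-- The maximum of the functional `c` over `⋃ σ, {β | 1 ≤ β ∘ σ ≤ B}`. -/
noncomputable def optimalValue {n : ℕ} (B : Fin n → ℕ) (c : Fin n → ℝ) : ℝ :=
  ∑ k, max (c (Tuple.sort (fun i => max (c i) 0) k)) 0 * (B k : ℝ) - ∑ i, max (-c i) 0

lemma mul_le_posPart_mul_sub {x β B : ℝ} (h1 : 1 ≤ β) (h2 : β ≤ B) :
    x * β ≤ max x 0 * B - max (-x) 0 := by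
  rcases le_total x 0 with hx | hx
  · rw [max_eq_right hx, max_eq_left (by linarith)]; nlinarith
  · rw [max_eq_left hx, max_eq_right (by linarith)]; nlinarith

lemma mul_eq_posPart_mul_sub_iff {x β B : ℝ} :
    x * β = max x 0 * B - max (-x) 0 ↔ (0 < x → β = B) ∧ (x < 0 → β = 1) := by
  rcases lt_trichotomy x 0 with hx | rfl | hx
  · rw [max_eq_right hx.le, max_eq_left (by linarith)]
    simp only [hx, hx.not_gt, IsEmpty.forall_iff, true_and, forall_const]
    constructor
    · intro h; apply mul_left_cancel₀ hx.ne; linarith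
    · rintro rfl; ring
  · simp
  · rw [max_eq_left hx.le, max_eq_right (by linarith)]
    simp [hx, hx.not_gt, hx.ne']

section Maximum

variable {n : ℕ} {B : Fin n → ℕ} {c : Fin n → ℝ}

/-- The rearrangement inequality. Strictness of `B` is what makes equality force a fully sorted
order. -/
lemma sum_posPart_comp_le (hB : StrictMono B) (σ : Equiv.Perm (Fin n)) :
    ∑ k, max (c (σ k)) 0 * (B k : ℝ) ≤
      ∑ k, max (c (Tuple.sort (fun i => max (c i) 0) k)) 0 * (B k : ℝ) ∧
    (∑ k, max (c (σ k)) 0 * (B k : ℝ) =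
      ∑ k, max (c (Tuple.sort (fun i => max (c i) 0) k)) 0 * (B k : ℝ) ↔
      Monotone (fun k => max (c (σ k)) 0)) := by
  set s := Tuple.sort (fun i => max (c i) 0) with hs
  have hmono : Monotone (fun k => max (c (s k)) 0) := Tuple.monotone_sort (fun i => max (c i) 0)
  have hBm : StrictMono (fun k => (B k : ℝ)) := fun i j h => Nat.cast_lt.2 (hB h)
  have hv : Monovary (fun k => max (c (s k)) 0) (fun k => (B k : ℝ)) :=
    hmono.monovary hBm.monotone
  have h1 := hv.sum_comp_perm_mul_le_sum_mul (σ := σ.trans s.symm)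
  have h2 := hv.sum_comp_perm_mul_eq_sum_mul_iff (σ := σ.trans s.symm)
  simp only [Equiv.trans_apply, Equiv.apply_symm_apply] at h1 h2
  refine ⟨h1, h2.trans ⟨fun h i j hij => ?_, fun h => ?_⟩⟩
  · rcases hij.eq_or_lt with rfl | hij
    · exact le_rfl
    · simpa using h (hBm hij)
  · intro i j hij
    simpa using h (hBm.lt_iff_lt.1 hij).le

lemma sum_eq_comp (c : Fin n → ℝ) (β : Fin n → ℕ) (σ : Equiv.Perm (Fin n)) :
    ∑ i, c i * (β i : ℝ) = ∑ k, c (σ k) * (β (σ k) : ℝ) :=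
  (Equiv.sum_comp σ fun i => c i * (β i : ℝ)).symm

lemma sum_bound_eq (c : Fin n → ℝ) (σ : Equiv.Perm (Fin n)) :
    ∑ k, (max (c (σ k)) 0 * (B k : ℝ) - max (-c (σ k)) 0) =
      ∑ k, max (c (σ k)) 0 * (B k : ℝ) - ∑ i, max (-c i) 0 := by
  rw [Finset.sum_sub_distrib, Equiv.sum_comp σ fun i => max (-c i) 0]

lemma sum_mul_le_optimalValue (hB : StrictMono B) {β : Fin n → ℕ} (hβ : ∀ i, 0 < β i)
    {σ : Equiv.Perm (Fin n)} (hσ : ∀ k, β (σ k) ≤ B k) :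
    ∑ i, c i * (β i : ℝ) ≤ optimalValue B c := by
  rw [sum_eq_comp c β σ]
  refine (Finset.sum_le_sum fun k _ => mul_le_posPart_mul_sub (x := c (σ k))
    (β := β (σ k)) (B := B k) (by exact_mod_cast hβ _) (by exact_mod_cast hσ k)).trans ?_
  rw [sum_bound_eq, optimalValue]
  exact sub_le_sub_right (sum_posPart_comp_le hB σ).1 _

/-- The upper bound combines a coordinatewise estimate with rearrangement. Attaining it forces
equality in both, and these two equality cases make up `IsOptimal`. -/
lemma isOptimal_iff (hB : StrictMono B) {β : Fin n → ℕ} :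
    IsOptimal B c β ↔ ((∀ i, 0 < β i) ∧ ∃ σ : Equiv.Perm (Fin n), ∀ k, β (σ k) ≤ B k) ∧
      ∑ i, c i * (β i : ℝ) = optimalValue B c := by
  constructor
  · rintro ⟨σ, hσ, h⟩
    refine ⟨⟨fun i => by simpa using (h (σ.symm i)).1, σ, fun k => (h k).2.1⟩, ?_⟩
    rw [sum_eq_comp c β σ, optimalValue, ← (sum_posPart_comp_le hB σ).2.2 hσ, ← sum_bound_eq]
    refine Finset.sum_congr rfl fun k _ => mul_eq_posPart_mul_sub_iff.2 ⟨?_, ?_⟩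
    · intro hk; exact_mod_cast (h k).2.2.1 hk
    · intro hk; exact_mod_cast (h k).2.2.2 hk
  · rintro ⟨⟨hβ, σ, hσ⟩, h⟩
    have hle : ∀ k ∈ Finset.univ, c (σ k) * (β (σ k) : ℝ) ≤
        max (c (σ k)) 0 * (B k : ℝ) - max (-c (σ k)) 0 := fun k _ =>
      mul_le_posPart_mul_sub (by exact_mod_cast hβ _) (by exact_mod_cast hσ k)
    have h1 := Finset.sum_le_sum hle
    have h2 := (sum_posPart_comp_le (c := c) hB σ).1
    have h3 := sum_bound_eq (B := B) c σ
    rw [sum_eq_comp c β σ, optimalValue] at h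
    have h4 := (Finset.sum_eq_sum_iff_of_le hle).1 (by linarith)
    refine ⟨σ, (sum_posPart_comp_le hB σ).2.1 (by linarith), fun k => ⟨hβ _, hσ k, ?_, ?_⟩⟩
    · intro hk; exact_mod_cast (mul_eq_posPart_mul_sub_iff.1 (h4 k (Finset.mem_univ k))).1 hk
    · intro hk; exact_mod_cast (mul_eq_posPart_mul_sub_iff.1 (h4 k (Finset.mem_univ k))).2 hk

end Maximum

/-- Any way of ordering the coordinates compatibly with `c`, together with any admissible choice
of the coordinates where `c` vanishes, gives an optimal point. -/
lemma isOptimal_mk {n : ℕ} {R : Type*} [LinearOrder R] [Zero R] {B : Fin n → ℕ}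
    (hB : ∀ k, 0 < B k) {c : Fin n → R} {σ : Equiv.Perm (Fin n)}
    (hσ : Monotone (fun k => max (c (σ k)) 0)) (g : Fin n → ℕ)
    (hg : ∀ k, 0 < g k ∧ g k ≤ B k) :
    IsOptimal B c (fun i => if 0 < c i then B (σ.symm i) else if c i < 0 then 1
      else g (σ.symm i)) := by
  refine ⟨σ, hσ, fun k => ?_⟩
  simp only [Equiv.symm_apply_apply]
  rcases lt_trichotomy (c (σ k)) 0 with h | h | h
  · simp [h, h.not_gt, Nat.succ_le_iff.2 (hB k)]
  · simp [h, hg k]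
  · simp [h, h.not_gt, hB k]

/-- Sorting with an arbitrary tie-break. -/
lemma exists_sorting {n : ℕ} {R : Type*} [LinearOrder R] [Zero R] (c : Fin n → R)
    (t : Fin n → ℕ) :
    ∃ σ : Equiv.Perm (Fin n), Monotone (fun k => max (c (σ k)) 0) ∧
      ∀ i j, max (c i) 0 = max (c j) 0 → t i < t j → σ.symm i < σ.symm j := by
  let f : Fin n → R ×ₗ ℕ := fun i => toLex (max (c i) 0, t i)
  have hm := Tuple.monotone_sort f
  refine ⟨Tuple.sort f, fun k l hkl => ?_, fun i j hij ht => ?_⟩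
  · have := hm hkl
    simp only [Function.comp, f, Prod.Lex.toLex_le_toLex] at this
    rcases this with h | h
    · exact h.le
    · exact h.1.le
  · by_contra! h
    have := hm h
    simp only [Function.comp, Equiv.apply_symm_apply, f, Prod.Lex.toLex_le_toLex, hij,
      lt_irrefl, false_or, true_and] at this
    omega

lemma exists_isOptimal {n : ℕ} {R : Type*} [LinearOrder R] [Zero R] {B : Fin n → ℕ}
    (hB : ∀ k, 0 < B k) (c : Fin n → R) : ∃ β, IsOptimal B c β := by
  obtain ⟨σ, hσ, -⟩ := exists_sorting c 0
  exact ⟨_, isOptimal_mk hB hσ B fun k => ⟨hB k, le_rfl⟩⟩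

/-! ### Exposed faces as hulls of optimal points -/

/-- Split `V` into maximizers and the rest: a point of the hull is a combination of one point from
each hull, and positive weight on the second pushes `l` below `M`. -/
lemma convexHull_setOf_isMax {E : Type*} [AddCommGroup E] [Module ℝ E] [TopologicalSpace E]
    {V : Set E} {l : StrongDual ℝ E} {M : ℝ} (hV : ∀ v ∈ V, l v ≤ M) (hex : ∃ v ∈ V, l v = M) :
    {x ∈ convexHull ℝ V | ∀ y ∈ convexHull ℝ V, l y ≤ l x} =
      convexHull ℝ {v ∈ V | l v = M} := by
  obtain ⟨v₀, hv₀, hv₀M⟩ := hex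
  have hle : ∀ y ∈ convexHull ℝ V, l y ≤ M := fun y hy =>
    convexHull_min (t := {y | l y ≤ M}) hV (convex_halfSpace_le l.isLinear M) hy
  apply Set.Subset.antisymm
  · rintro x ⟨hx, hmax⟩
    have hxM : l x = M := le_antisymm (hle x hx) (hv₀M ▸ hmax v₀ (subset_convexHull ℝ V hv₀))
    by_cases hempty : Set.Nonempty {v ∈ V | l v < M}
    · have hunion : V = {v ∈ V | l v = M} ∪ {v ∈ V | l v < M} := by
        ext v
        constructor
        · intro hv
          rcases (hV v hv).eq_or_lt with h | h
          · exact Or.inl ⟨hv, h⟩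
          · exact Or.inr ⟨hv, h⟩
        · rintro (h | h) <;> exact h.1
      have hne : Set.Nonempty {v ∈ V | l v = M} := ⟨v₀, hv₀, hv₀M⟩
      rw [hunion, convexHull_union hne hempty, mem_convexJoin] at hx
      obtain ⟨u, hu, w, hw, a, b, ha, hb, hab, rfl⟩ := hx
      have huM : l u = M := convexHull_min (t := {y | l y = M}) (fun v hv => hv.2)
        (convex_hyperplane l.isLinear M) hu
      have hwM : l w < M := convexHull_min (t := {y | l y < M}) (fun v hv => hv.2)
        (convex_halfSpace_lt l.isLinear M) hw
      simp only [map_add, map_smul, smul_eq_mul, huM] at hxM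
      have hb0 : b = 0 := by
        by_contra hne
        have : 0 < b * (M - l w) := mul_pos (lt_of_le_of_ne hb (Ne.symm hne)) (by linarith)
        have ha' : a = 1 - b := by linarith
        rw [ha'] at hxM
        nlinarith
      have ha1 : a = 1 := by linarith
      simpa [hb0, ha1] using hu
    · have hsub : V ⊆ {v ∈ V | l v = M} := fun v hv => ⟨hv, by
        by_contra hne
        exact hempty ⟨v, hv, lt_of_le_of_ne (hV v hv) hne⟩⟩
      exact convexHull_mono hsub hx
  · intro x hx
    refine ⟨convexHull_mono (fun v hv => hv.1) hx, fun y hy => ?_⟩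
    have : l x = M := convexHull_min (t := {y | l y = M}) (fun v hv => hv.2)
      (convex_hyperplane l.isLinear M) hx
    exact this ▸ hle y hy

/-- The linear functional `x ↦ ∑ i, c i * x i`. -/
noncomputable def dotForm {n : ℕ} (c : Fin n → ℝ) : StrongDual ℝ (Fin n → ℝ) :=
  ∑ i, c i • ContinuousLinearMap.proj i

lemma dotForm_apply {n : ℕ} (c x : Fin n → ℝ) : dotForm c x = ∑ i, c i * x i := by
  simp [dotForm]

lemma exists_eq_dotForm {n : ℕ} (l : StrongDual ℝ (Fin n → ℝ)) : ∃ c, l = dotForm c := by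
  refine ⟨fun i => l (Pi.single i 1), ?_⟩
  ext x
  rw [dotForm_apply]
  conv_lhs => rw [← Finset.univ_sum_single x, map_sum]
  refine Finset.sum_congr rfl fun i _ => ?_
  have : (Pi.single i (x i) : Fin n → ℝ) = x i • Pi.single i 1 := by
    rw [← Pi.single_smul, smul_eq_mul, mul_one]
  rw [this, map_smul, smul_eq_mul, mul_comm]

/-- The optimal lattice points of `c`, as points of `ℝⁿ`. -/
def optimalSet {n : ℕ} {R : Type*} [LinearOrder R] [Zero R] (B : Fin n → ℕ) (c : Fin n → R) :
    Set (Fin n → ℝ) :=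
  {x | ∃ β : Fin n → ℕ, IsOptimal B c β ∧ x = fun i => (β i : ℝ)}

section Faces

variable {n : ℕ} {b : Fin n → ℕ}

lemma optimalSet_nonempty (hb : ∀ i, 0 < b i) {R : Type*} [LinearOrder R] [Zero R]
    (c : Fin n → R) : (optimalSet (prefixSum b) c).Nonempty := by
  obtain ⟨β, hβ⟩ := exists_isOptimal (prefixSum_pos hb) c
  exact ⟨_, β, hβ, rfl⟩

lemma optimalSet_eq (hb : ∀ i, 0 < b i) (c : Fin n → ℝ) :
    optimalSet (prefixSum b) c =
      {x ∈ {x | ∃ β : Fin n → ℕ, IsParkingFunction b β ∧ x = fun i => (β i : ℝ)} |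
        dotForm c x = optimalValue (prefixSum b) c} := by
  ext x
  constructor
  · rintro ⟨β, hβ, rfl⟩
    rw [isOptimal_iff (prefixSum_strictMono hb), ← isParkingFunction_iff hb] at hβ
    exact ⟨⟨β, hβ.1, rfl⟩, (dotForm_apply c _).trans hβ.2⟩
  · rintro ⟨⟨β, hβ, rfl⟩, h⟩
    refine ⟨β, ?_, rfl⟩
    rw [isOptimal_iff (prefixSum_strictMono hb), ← isParkingFunction_iff hb]
    exact ⟨hβ, (dotForm_apply c _).symm.trans h⟩

/-- The face of the parking polytope where `c` is maximal is spanned by the optimal points. -/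
lemma setOf_isMax_parkingPolytope (hb : ∀ i, 0 < b i) (c : Fin n → ℝ) :
    {x ∈ parkingPolytope b | ∀ y ∈ parkingPolytope b, dotForm c y ≤ dotForm c x} =
      convexHull ℝ (optimalSet (prefixSum b) c) := by
  rw [optimalSet_eq hb]
  refine convexHull_setOf_isMax ?_ ?_
  · rintro _ ⟨β, hβ, rfl⟩
    rw [isParkingFunction_iff hb] at hβ
    obtain ⟨h1, σ, hσ⟩ := hβ
    rw [dotForm_apply]
    exact sum_mul_le_optimalValue (prefixSum_strictMono hb) h1 hσ
  · obtain ⟨x, hx⟩ := optimalSet_nonempty hb c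
    rw [optimalSet_eq hb] at hx
    exact ⟨x, hx⟩

/-- The optimal points of `c` are the parking functions in the face of `c`. -/
lemma isOptimal_of_convexHull_eq (hb : ∀ i, 0 < b i) {c d : Fin n → ℝ}
    (h : convexHull ℝ (optimalSet (prefixSum b) c) = convexHull ℝ (optimalSet (prefixSum b) d))
    {β : Fin n → ℕ} (hβ : IsOptimal (prefixSum b) c β) : IsOptimal (prefixSum b) d β := by
  have hmem : (fun i => (β i : ℝ)) ∈ convexHull ℝ (optimalSet (prefixSum b) d) :=
    h ▸ subset_convexHull ℝ _ ⟨β, hβ, rfl⟩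
  rw [isOptimal_iff (prefixSum_strictMono hb)] at hβ ⊢
  refine ⟨hβ.1, ?_⟩
  rw [← dotForm_apply d fun i => (β i : ℝ)]
  rw [optimalSet_eq hb] at hmem
  exact convexHull_min (t := {y | dotForm d y = optimalValue (prefixSum b) d})
    (fun v hv => hv.2) (convex_hyperplane (dotForm d).isLinear _) hmem

lemma isOptimal_intCast {B : Fin n → ℕ} {ρ : Fin n → ℤ} {β : Fin n → ℕ} :
    IsOptimal B (fun i => (ρ i : ℝ)) β ↔ IsOptimal B ρ β := by
  refine isOptimal_congr (fun i => by simp) (fun i => by simp) fun i j => ?_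
  exact_mod_cast Iff.rfl

lemma optimalSet_intCast {B : Fin n → ℕ} {ρ : Fin n → ℤ} :
    optimalSet B (fun i => (ρ i : ℝ)) = optimalSet B ρ := by
  simp only [optimalSet, isOptimal_intCast]

lemma isOptimal_iff_of_convexHull_eq (hb : ∀ i, 0 < b i) {ρ ρ' : Fin n → ℤ}
    (h : convexHull ℝ (optimalSet (prefixSum b) ρ) = convexHull ℝ (optimalSet (prefixSum b) ρ'))
    {β : Fin n → ℕ} : IsOptimal (prefixSum b) ρ β ↔ IsOptimal (prefixSum b) ρ' β := by
  rw [← optimalSet_intCast, ← optimalSet_intCast] at h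
  rw [← isOptimal_intCast, ← isOptimal_intCast (ρ := ρ')]
  exact ⟨isOptimal_of_convexHull_eq hb h, isOptimal_of_convexHull_eq hb h.symm⟩

lemma vectorSpan_convexHull {E : Type*} [AddCommGroup E] [Module ℝ E] (s : Set E) :
    vectorSpan ℝ (convexHull ℝ s) = vectorSpan ℝ s := by
  rw [← direction_affineSpan, affineSpan_convexHull, direction_affineSpan]

/-- The nonempty exposed faces are exactly the hulls of optimal sets. -/
lemma mem_facesOfDim_iff (hb : ∀ i, 0 < b i) {k : ℕ} {F : Set (Fin n → ℝ)} :
    F ∈ facesOfDim (parkingPolytope b) k ↔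
      ∃ c : Fin n → ℝ, F = convexHull ℝ (optimalSet (prefixSum b) c) ∧
        Module.finrank ℝ (vectorSpan ℝ (optimalSet (prefixSum b) c)) = k := by
  constructor
  · rintro ⟨hne, hexp, hk⟩
    obtain ⟨l, hl⟩ := hexp hne
    obtain ⟨c, rfl⟩ := exists_eq_dotForm l
    rw [setOf_isMax_parkingPolytope hb] at hl
    refine ⟨c, hl, ?_⟩
    rw [← hk, hl, vectorSpan_convexHull]
  · rintro ⟨c, rfl, hk⟩
    refine ⟨(optimalSet_nonempty hb c).convexHull, fun _ => ⟨dotForm c, ?_⟩, ?_⟩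
    · rw [setOf_isMax_parkingPolytope hb]
    · rw [vectorSpan_convexHull, hk]

end Faces

/-! ### Level maps as combinatorial types of functionals -/

/-- `ρ` takes values in `{-1, 0, …, r}` and attains each of `1, …, r`. -/
def IsLevelMap {n : ℕ} (r : ℕ) (ρ : Fin n → ℤ) : Prop :=
  (∀ i, -1 ≤ ρ i ∧ ρ i ≤ r) ∧ ∀ t : ℤ, 1 ≤ t → t ≤ r → ∃ i, ρ i = t

lemma exists_card_filter_le_eq {R : Type*} [LinearOrder R] (S : Finset R) :
    ∀ t : ℕ, 1 ≤ t → t ≤ S.card → ∃ v ∈ S, (S.filter (· ≤ v)).card = t := by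
  induction S using Finset.induction_on_max with
  | empty => intro t h1 h2; simp at h2; omega
  | insert a S ha ih =>
    have haS : a ∉ S := fun h => lt_irrefl a (ha a h)
    intro t h1 h2
    rw [Finset.card_insert_of_notMem haS] at h2
    rcases h2.eq_or_lt with rfl | h2
    · refine ⟨a, Finset.mem_insert_self a S, ?_⟩
      rw [Finset.filter_true_of_mem, Finset.card_insert_of_notMem haS]
      intro x hx
      rcases Finset.mem_insert.1 hx with rfl | hx
      · exact le_rfl
      · exact (ha x hx).le
    · obtain ⟨v, hv, hvt⟩ := ih t h1 (by omega)
      refine ⟨v, Finset.mem_insert_of_mem hv, ?_⟩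
      rw [Finset.filter_insert, if_neg (not_le.2 (ha v hv)), hvt]

/-- Every weight vector has the same signs and the same order of positive parts as a level map. -/
lemma exists_isLevelMap {n : ℕ} (c : Fin n → ℝ) :
    ∃ (r : ℕ) (ρ : Fin n → ℤ), IsLevelMap r ρ ∧ (∀ i, c i < 0 ↔ ρ i < 0) ∧
      (∀ i, 0 < c i ↔ 0 < ρ i) ∧
      ∀ i j, max (c i) 0 ≤ max (c j) 0 ↔ max (ρ i) 0 ≤ max (ρ j) 0 := by
  classical
  -- A positive value of `c` is replaced by its rank `g` among the distinct positive values; all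
  -- negative values collapse to `-1`.
  set S : Finset ℝ := (Finset.univ.image c).filter (0 < ·) with hS
  set g : ℝ → ℕ := fun x => (S.filter (· ≤ x)).card with hg
  have hgmono : Monotone g := fun x y hxy =>
    Finset.card_le_card fun v hv => by
      rw [Finset.mem_filter] at hv ⊢
      exact ⟨hv.1, hv.2.trans hxy⟩
  have hmem : ∀ i, 0 < c i → c i ∈ S := fun i hi => by simp [hS, hi]
  have hgz : ∀ x, x ≤ 0 → g x = 0 := fun x hx => by
    rw [hg]
    simp only [Finset.card_eq_zero, Finset.filter_eq_empty_iff, not_le]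
    intro v hv
    rw [hS, Finset.mem_filter] at hv
    exact hx.trans_lt hv.2
  have hlt : ∀ i x, 0 < c i → x < c i → g x < g (c i) := fun i x hi hx => by
    refine Finset.card_lt_card (Finset.ssubset_iff_of_subset ?_ |>.2 ⟨c i, ?_, ?_⟩)
    · intro v hv
      rw [Finset.mem_filter] at hv ⊢
      exact ⟨hv.1, hv.2.trans hx.le⟩
    · simp [hmem i hi]
    · simp [hx]
  have hgp : ∀ i, 0 < c i → 0 < g (c i) := fun i hi => (Nat.zero_le _).trans_lt (hlt i 0 hi hi)
  have hgmax : ∀ i, g (max (c i) 0) = g (c i) := fun i => by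
    rcases le_total (c i) 0 with h | h
    · rw [max_eq_right h, hgz _ h, hgz _ le_rfl]
    · rw [max_eq_left h]
  set ρ : Fin n → ℤ := fun i => if c i < 0 then -1 else g (c i) with hρ
  have hρmax : ∀ i, max (ρ i) 0 = g (max (c i) 0) := fun i => by
    rw [hgmax]
    simp only [hρ]
    split_ifs with h
    · simp [hgz _ h.le]
    · simp
  refine ⟨S.card, ρ, ⟨fun i => ?_, fun t h1 h2 => ?_⟩, fun i => ?_, fun i => ?_, fun i j => ?_⟩
  · simp only [hρ]
    split_ifs with h
    · constructor <;> omega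
    · have : g (c i) ≤ S.card := Finset.card_filter_le _ _
      constructor <;> omega
  · obtain ⟨v, hv, hvt⟩ := exists_card_filter_le_eq S t.toNat (by omega) (by omega)
    have hv' := hv
    simp only [hS, Finset.mem_filter, Finset.mem_image, Finset.mem_univ, true_and] at hv'
    obtain ⟨⟨i, rfl⟩, hpos⟩ := hv'
    refine ⟨i, ?_⟩
    simp only [hρ, if_neg hpos.not_gt, hg, hvt]
    omega
  · simp only [hρ]
    split_ifs with h <;> simp [h]
  · simp only [hρ]
    split_ifs with h
    · simp [h.le]
    · refine ⟨fun h' => by exact_mod_cast hgp i h', fun h' => ?_⟩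
      by_contra hle
      rw [hgz _ (not_lt.1 hle)] at h'
      simp at h'
  · rw [hρmax, hρmax, Nat.cast_le]
    refine ⟨fun h => hgmono h, fun h => ?_⟩
    by_contra! hlt'
    have hi : 0 < c i := by
      rcases lt_max_iff.1 hlt' with h' | h'
      · exact (le_max_right _ _).trans_lt h'
      · exact absurd h' (not_lt.2 (le_max_right _ _))
    rw [max_eq_left hi.le] at hlt' h
    exact absurd (hlt i _ hi hlt') (not_lt.2 h)

/-- Since `ρ` skips no level, below a coordinate of level `t + 1` there is a chain through levels
`1, …, t`, along which `ρ'` must grow by at least one each time. -/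
lemma IsLevelMap.le_of_order {n r : ℕ} {ρ ρ' : Fin n → ℤ} (h : IsLevelMap r ρ)
    (hpos : ∀ i, 0 < ρ i → 0 < ρ' i) (hlt : ∀ i j, 0 < ρ i → ρ i < ρ j → ρ' i < ρ' j) :
    ∀ (t : ℕ) (i : Fin n), ρ i = t + 1 → ρ i ≤ ρ' i := by
  intro t
  induction t with
  | zero => intro i hi; have := hpos i (by omega); omega
  | succ t ih =>
    intro i hi
    obtain ⟨j, hj⟩ := h.2 (t + 1) (by omega) (by have := (h.1 i).2; push_cast at hi; omega)
    have h1 := ih j hj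
    have h2 := hlt j i (by omega) (by push_cast at hi; omega)
    push_cast at hi
    omega

/-- A level map is determined by its signs and the order of its positive values. -/
lemma IsLevelMap.ext {n r r' : ℕ} {ρ ρ' : Fin n → ℤ} (h : IsLevelMap r ρ) (h' : IsLevelMap r' ρ')
    (hneg : ∀ i, ρ i < 0 ↔ ρ' i < 0) (hnonpos : ∀ i, ρ i ≤ 0 ↔ ρ' i ≤ 0)
    (hlt : ∀ i j, 0 < ρ i → ρ i < ρ j → ρ' i < ρ' j)
    (hlt' : ∀ i j, 0 < ρ' i → ρ' i < ρ' j → ρ i < ρ j) : ρ = ρ' := by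
  funext i
  have h1 := (h.1 i).1
  have h1' := (h'.1 i).1
  have h2 := hneg i
  have h3 := hnonpos i
  by_cases hi : 0 < ρ i
  · refine le_antisymm ?_ ?_
    · exact h.le_of_order (fun j hj => by have := hnonpos j; omega) hlt (ρ i - 1).toNat i
        (by omega)
    · exact h'.le_of_order (fun j hj => by have := hnonpos j; omega) hlt' (ρ' i - 1).toNat i
        (by omega)
  · omega

/-! ### Reduced level maps: uniqueness and existence -/

/-- The level maps whose optimal set is not already described by a simpler level map. -/
def IsReducedMap {n : ℕ} (B : Fin n → ℕ) (ρ : Fin n → ℤ) : Prop :=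
  (∃ k, B k = 1) → (Finset.univ.filter fun i => ρ i ≤ 0).card ≠ 1

section Reduced

variable {n : ℕ} {B : Fin n → ℕ} {ρ ρ' : Fin n → ℤ}

lemma StrictMono.lt_of_eq_one (hB : StrictMono B) (hpos : ∀ k, 0 < B k) {k l : Fin n}
    (hk : B k = 1) (hl : l ≠ k) : k < l := by
  rcases lt_trichotomy k l with h | h | h
  · exact h
  · exact absurd h.symm hl
  · have h1 := hB h
    have h2 := hpos l
    omega

lemma exists_isOptimal_eq_one (hpos : ∀ k, 0 < B k) (ρ : Fin n → ℤ) :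
    ∃ β, IsOptimal B ρ β ∧ ∀ i, ρ i ≤ 0 → β i = 1 := by
  obtain ⟨σ, hσ, -⟩ := exists_sorting ρ 0
  refine ⟨_, isOptimal_mk hpos hσ 1 fun k => ⟨Nat.one_pos, hpos k⟩, fun i hi => ?_⟩
  simp [hi.not_gt]

/-- Put `i` last among the nonpositive coordinates. Its bound could be `1` only if it were the sole
such coordinate, which reducedness excludes. Hence a zero coordinate really can vary. -/
lemma IsReducedMap.exists_sorting (hB : StrictMono B) (hpos : ∀ k, 0 < B k) (h : IsReducedMap B ρ)
    {i : Fin n} (hi : ρ i = 0) :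
    ∃ σ : Equiv.Perm (Fin n), Monotone (fun k => max (ρ (σ k)) 0) ∧ 1 < B (σ.symm i) := by
  obtain ⟨σ, hσ, ht⟩ := _root_.exists_sorting ρ (Pi.single i 1)
  refine ⟨σ, hσ, ?_⟩
  by_contra hle
  have h1 : B (σ.symm i) = 1 := by have := hpos (σ.symm i); omega
  refine h ⟨_, h1⟩ (Finset.card_eq_one.2 ⟨i, ?_⟩)
  ext j
  simp only [Finset.mem_filter, Finset.mem_univ, true_and, Finset.mem_singleton]
  refine ⟨fun hj => ?_, fun hj => by rw [hj, hi]⟩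
  by_contra hne
  have := hB (ht j i (by rw [hi, max_eq_right hj, max_self]) (by simp [hne]))
  have := hpos (σ.symm j)
  omega

lemma IsOptimal.apply_symm {β : Fin n → ℕ} (h : IsOptimal B ρ β) :
    ∃ σ : Equiv.Perm (Fin n), (∀ i j, max (ρ i) 0 < max (ρ j) 0 → σ.symm i < σ.symm j) ∧
      ∀ i, β i ≤ B (σ.symm i) ∧ (0 < ρ i → β i = B (σ.symm i)) := by
  obtain ⟨σ, hσ, h⟩ := h
  refine ⟨σ, fun i j hij => ?_, fun i => ?_⟩
  · by_contra! hle
    have := hσ hle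
    simp only [Equiv.apply_symm_apply] at this
    exact absurd hij (not_lt.2 this)
  · have := h (σ.symm i)
    simp only [Equiv.apply_symm_apply] at this
    exact ⟨this.2.1, this.2.2.1⟩

lemma IsOptimal.eq_one_of_neg {β : Fin n → ℕ} (h : IsOptimal B ρ β) {i : Fin n} (hi : ρ i < 0) :
    β i = 1 := by
  obtain ⟨σ, -, h⟩ := h
  have := (h (σ.symm i)).2.2.2
  simp only [Equiv.apply_symm_apply] at this
  exact this hi

/-- Test with a point equal to `1` wherever `ρ ≤ 0`. If `ρ' i > 0`, then `i` occupies the place of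
bound `1`, so every other coordinate comes after it, is also positive for `ρ'`, and has entry above
`1`. Thus `i` is the only nonpositive coordinate of `ρ`. -/
lemma IsReducedMap.nonpos_of_nonpos (hB : StrictMono B) (hpos : ∀ k, 0 < B k) (h : IsReducedMap B ρ)
    (heq : ∀ β, IsOptimal B ρ β ↔ IsOptimal B ρ' β) {i : Fin n} (hi : ρ i ≤ 0) : ρ' i ≤ 0 := by
  by_contra! hi'
  obtain ⟨β, hβ, hβ1⟩ := exists_isOptimal_eq_one hpos ρ
  obtain ⟨σ, hσ, hβσ⟩ := ((heq β).1 hβ).apply_symm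
  have h1 : B (σ.symm i) = 1 := by rw [← (hβσ i).2 hi', hβ1 i hi]
  refine h ⟨_, h1⟩ (Finset.card_eq_one.2 ⟨i, ?_⟩)
  ext j
  simp only [Finset.mem_filter, Finset.mem_univ, true_and, Finset.mem_singleton]
  refine ⟨fun hj => ?_, fun hj => hj ▸ hi⟩
  by_contra hne
  have hlt : σ.symm i < σ.symm j :=
    hB.lt_of_eq_one hpos h1 fun h => hne (σ.symm.injective h)
  have hj' : 0 < ρ' j := by
    by_contra! hj'
    have := hσ j i (by rw [max_eq_right hj', max_eq_left hi'.le]; exact hi')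
    exact absurd hlt this.not_gt
  have h2 := (hβσ j).2 hj'
  have h3 := hB hlt
  have h4 := hβ1 j hj
  omega

lemma IsReducedMap.neg_of_neg (hB : StrictMono B) (hpos : ∀ k, 0 < B k) (h : IsReducedMap B ρ)
    (h' : IsReducedMap B ρ') (heq : ∀ β, IsOptimal B ρ β ↔ IsOptimal B ρ' β) {i : Fin n}
    (hi : ρ i < 0) : ρ' i < 0 := by
  refine lt_of_le_of_ne (h.nonpos_of_nonpos hB hpos heq hi.le) fun h0 => ?_
  obtain ⟨σ, hσ, h1⟩ := h'.exists_sorting hB hpos h0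
  have hβ := isOptimal_mk hpos hσ B fun k => ⟨hpos k, le_rfl⟩
  have := ((heq _).2 hβ).eq_one_of_neg hi
  simp only [h0, lt_irrefl, if_false] at this
  omega

/-- Otherwise the tie-break can place `j` before `i` for `ρ'`, giving a common optimal point with `β
j < β i`, while `ρ` demands `β i < β j`. -/
lemma lt_of_lt_of_isOptimal_iff (hB : StrictMono B) (hpos : ∀ k, 0 < B k)
    (heq : ∀ β, IsOptimal B ρ β ↔ IsOptimal B ρ' β) {i j : Fin n} (hi : 0 < ρ i)
    (hi' : 0 < ρ' i) (hij : ρ i < ρ j) : ρ' i < ρ' j := by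
  by_contra! hle
  obtain ⟨σ, hσ, ht⟩ := exists_sorting ρ' (Pi.single i 1)
  have hne : j ≠ i := fun h => by simp [h] at hij
  have hlt : σ.symm j < σ.symm i := by
    rcases (max_le_max_right 0 hle).eq_or_lt with h | h
    · exact ht j i h (by simp [hne])
    · by_contra! h'
      have := hσ h'
      simp only [Equiv.apply_symm_apply] at this
      exact absurd h (not_lt.2 this)
  have hβ := (heq _).2 (isOptimal_mk hpos hσ B fun k => ⟨hpos k, le_rfl⟩)
  set β : Fin n → ℕ := fun i => if 0 < ρ' i then B (σ.symm i) else if ρ' i < 0 then 1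
      else B (σ.symm i) with hβdef
  have h1 : β i = B (σ.symm i) := by simp [hβdef, hi']
  have h2 : β j ≤ B (σ.symm j) := by
    simp only [hβdef]
    split_ifs
    · exact le_rfl
    · exact hpos _
    · exact le_rfl
  obtain ⟨τ, hτ, hβτ⟩ := hβ.apply_symm
  have h3 := (hβτ i).2 hi
  have h4 := (hβτ j).2 (hi.trans hij)
  have h5 := hB (hτ i j (by rw [max_eq_left hi.le, max_eq_left (hi.trans hij).le]; exact hij))
  have h6 := hB hlt
  omega

/-- Reduced level maps are determined by their optimal points. -/
lemma IsLevelMap.eq_of_isOptimal_iff (hB : StrictMono B) (hpos : ∀ k, 0 < B k) {r r' : ℕ}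
    (hρ : IsLevelMap r ρ) (hρ' : IsLevelMap r' ρ') (h : IsReducedMap B ρ) (h' : IsReducedMap B ρ')
    (heq : ∀ β, IsOptimal B ρ β ↔ IsOptimal B ρ' β) : ρ = ρ' := by
  have heq' := fun β => (heq β).symm
  have hnp : ∀ i, ρ i ≤ 0 ↔ ρ' i ≤ 0 := fun i =>
    ⟨h.nonpos_of_nonpos hB hpos heq, h'.nonpos_of_nonpos hB hpos heq'⟩
  refine hρ.ext hρ' (fun i => ⟨h.neg_of_neg hB hpos h' heq, h'.neg_of_neg hB hpos h heq'⟩) hnp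
    (fun i j hi hij => ?_) (fun i j hi hij => ?_)
  · exact lt_of_lt_of_isOptimal_iff hB hpos heq hi (by have := hnp i; omega) hij
  · exact lt_of_lt_of_isOptimal_iff hB hpos heq' hi (by have := hnp i; omega) hij

lemma IsLevelMap.exists_isReduced (hB : StrictMono B) (hpos : ∀ k, 0 < B k) {r : ℕ}
    (hρ : IsLevelMap r ρ) :
    ∃ (s : ℕ) (ρ' : Fin n → ℤ), IsLevelMap s ρ' ∧ IsReducedMap B ρ' ∧
      ∀ β, IsOptimal B ρ β ↔ IsOptimal B ρ' β := by
  by_cases hred : IsReducedMap B ρ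
  · exact ⟨r, ρ, hρ, hred, fun _ => Iff.rfl⟩
  simp only [IsReducedMap, not_forall, not_not] at hred
  obtain ⟨⟨k, hk⟩, hcard⟩ := hred
  obtain ⟨z, hz⟩ := Finset.card_eq_one.1 hcard
  have hz' : ∀ i, ρ i ≤ 0 ↔ i = z := fun i => by
    have : i ∈ Finset.univ.filter (fun i => ρ i ≤ 0) ↔ i = z := by rw [hz, Finset.mem_singleton]
    simpa using this
  -- The sole nonpositive coordinate `z` is sorted to the place of bound `1`, so its sign is
  -- irrelevant; it becomes the new lowest level and the others move up.
  set ρ' : Fin n → ℤ := fun i => if i = z then 1 else ρ i + 1 with hρ'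
  have hval : ∀ i, ρ' i = max (ρ i) 0 + 1 := fun i => by
    simp only [hρ']
    split_ifs with h
    · rw [max_eq_right ((hz' i).2 h)]; rfl
    · rw [max_eq_left]
      have := hz' i
      omega
  have hpos' : ∀ i, 0 < ρ' i := fun i => by
    rw [hval]; have := le_max_right (ρ i) 0; omega
  refine ⟨r + 1, ρ', ⟨fun i => ⟨(by have := hpos' i; omega), ?_⟩, fun t h1 h2 => ?_⟩, ?_, ?_⟩
  · rw [hval]
    push_cast
    have := (hρ.1 i).2
    omega
  · rcases h1.eq_or_lt with rfl | h1
    · exact ⟨z, by simp [hρ']⟩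
    · obtain ⟨i, hi⟩ := hρ.2 (t - 1) (by omega) (by push_cast at h2; omega)
      exact ⟨i, by rw [hval]; omega⟩
  · intro _
    rw [Finset.filter_false_of_mem fun i _ => not_le.2 (hpos' i)]
    simp
  · intro β
    refine exists_congr fun σ => ?_
    have hm : ∀ i, max (ρ' i) 0 = max (ρ i) 0 + 1 := fun i => by
      rw [max_eq_left (hpos' i).le, hval]
    have hmono : Monotone (fun k => max (ρ' (σ k)) 0) ↔ Monotone (fun k => max (ρ (σ k)) 0) := by
      simp only [Monotone, hm, add_le_add_iff_right]
    rw [hmono]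
    refine and_congr_right fun hσ => forall_congr' fun l => ?_
    by_cases hl : σ l = z
    · have hl1 : B l = 1 := by
        by_contra hne
        have hkl : k ≠ l := fun h => hne (h ▸ hk)
        have hlt := hB.lt_of_eq_one hpos hk hkl.symm
        have h1 := hσ hlt.le
        simp only [max_eq_right ((hz' _).2 hl)] at h1
        exact hkl (σ.injective (((hz' _).1 ((le_max_left _ _).trans h1)).trans hl.symm))
      have h1 := (hz' _).2 hl
      have h2 := hpos' (σ l)
      constructor
      · rintro ⟨h3, h4, -, -⟩
        exact ⟨h3, h4, fun _ => by omega, fun _ => by omega⟩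
      · rintro ⟨h3, h4, -, -⟩
        exact ⟨h3, h4, fun _ => by omega, fun _ => by omega⟩
    · have h1 : 0 < ρ (σ l) := not_le.1 fun h => hl ((hz' _).1 h)
      simp [h1, hpos' (σ l), h1.not_gt, (hpos' (σ l)).not_gt]

end Reduced

/-! ### Dimension of the faces -/

/-- A subspace of `ℝⁿ` whose annihilator consists of the functions pulled back along `p` has
codimension the number of classes of `p`. -/
lemma finrank_add_card_of_annihilator {n : ℕ} {κ : Type*} [Fintype κ] (p : Fin n → Option κ)
    (hp : ∀ k, ∃ i, p i = some k) (W : Submodule ℝ (Fin n → ℝ))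
    (hW : ∀ f : Fin n → ℝ, (∀ w ∈ W, ∑ i, f i * w i = 0) ↔
      (∀ i, p i = none → f i = 0) ∧ ∀ i j, p i = p j → f i = f j) :
    Module.finrank ℝ W + Fintype.card κ = n := by
  classical
  let ext : (κ → ℝ) →ₗ[ℝ] (Fin n → ℝ) :=
    { toFun := fun h i => (p i).elim 0 h
      map_add' := fun h h' => by funext i; cases hi : p i <;> simp [hi]
      map_smul' := fun a h => by funext i; cases hi : p i <;> simp [hi] }
  let dot : (Fin n → ℝ) ≃ₗ[ℝ] Module.Dual ℝ (Fin n → ℝ) := (Pi.basisFun ℝ (Fin n)).toDualEquiv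
  have hdot : ∀ f x, dot f x = ∑ i, f i * x i := fun f x => by
    simp only [dot, Module.Basis.toDualEquiv_apply]
    conv_lhs => rw [← (Pi.basisFun ℝ (Fin n)).sum_repr f, map_sum,
      LinearMap.sum_apply]
    refine Finset.sum_congr rfl fun i _ => ?_
    rw [map_smul, LinearMap.smul_apply, Module.Basis.toDual_apply_right]
    simp
  have hext : Function.Injective ext := fun h h' hh => by
    funext k
    obtain ⟨i, hi⟩ := hp k
    have := congrFun hh i
    simpa [ext, hi] using this
  have hrange : LinearMap.range (dot.toLinearMap ∘ₗ ext) = W.dualAnnihilator := by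
    ext l
    obtain ⟨f, rfl⟩ := dot.surjective l
    rw [Submodule.mem_dualAnnihilator]
    simp only [hdot, hW, LinearMap.mem_range, LinearMap.comp_apply, LinearEquiv.coe_coe,
      EmbeddingLike.apply_eq_iff_eq]
    constructor
    · rintro ⟨h, rfl⟩
      refine ⟨fun i hi => ?_, fun i j hij => ?_⟩
      · simp [ext, hi]
      · simp [ext, hij]
    · rintro ⟨h1, h2⟩
      choose q hq using hp
      refine ⟨fun k => f (q k), ?_⟩
      funext i
      cases hi : p i with
      | none => simp [ext, hi, h1 i hi]
      | some k =>
        simp only [ext, LinearMap.coe_mk, AddHom.coe_mk, hi, Option.elim_some]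
        exact h2 _ _ ((hq k).trans hi.symm)
  have h1 := LinearMap.finrank_range_of_inj (f := dot.toLinearMap ∘ₗ ext)
    (dot.injective.comp hext)
  rw [hrange, Module.finrank_fintype_fun_eq_card] at h1
  have h2 := Subspace.finrank_add_finrank_dualAnnihilator_eq W
  rw [h1] at h2
  simpa using h2

section Dimension

variable {n : ℕ} {B : Fin n → ℕ} {ρ : Fin n → ℤ}

lemma IsOptimal.comp_perm {β : Fin n → ℕ} (h : IsOptimal B ρ β) {π : Equiv.Perm (Fin n)}
    (hπ : ∀ i, ρ (π i) = ρ i) : IsOptimal B ρ (β ∘ π) := by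
  obtain ⟨σ, hσ, h⟩ := h
  have hρ : ∀ k, ρ ((σ.trans π.symm) k) = ρ (σ k) := fun k => by
    rw [← hπ]; simp
  refine ⟨σ.trans π.symm, ?_, fun k => ?_⟩
  · simpa only [hρ] using hσ
  · rw [hρ]
    simpa using h k

/-- Negative coordinates contribute a constant and zero coordinates nothing. At a positive place `k`
the contribution depends only on the level there, which is the same for every sorting. -/
lemma IsOptimal.sum_eq {f : Fin n → ℝ} (hzero : ∀ i, ρ i = 0 → f i = 0)
    (hlevel : ∀ i j, 0 < ρ i → ρ i = ρ j → f i = f j) {β β' : Fin n → ℕ}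
    (h : IsOptimal B ρ β) (h' : IsOptimal B ρ β') :
    ∑ i, f i * (β i : ℝ) = ∑ i, f i * (β' i : ℝ) := by
  have key : ∀ {β : Fin n → ℕ}, IsOptimal B ρ β → ∃ σ : Equiv.Perm (Fin n),
      Monotone (fun k => max (ρ (σ k)) 0) ∧ ∑ i, f i * (β i : ℝ) =
        ∑ k, (if 0 < ρ (σ k) then f (σ k) else 0) * (B k : ℝ) +
          ∑ i, if ρ i < 0 then f i else 0 := by
    rintro β ⟨σ, hσ, h⟩
    refine ⟨σ, hσ, ?_⟩
    rw [← Equiv.sum_comp σ fun i => if ρ i < 0 then f i else 0, ← Finset.sum_add_distrib,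
      sum_eq_comp f β σ]
    refine Finset.sum_congr rfl fun k _ => ?_
    rcases lt_trichotomy (ρ (σ k)) 0 with hk | hk | hk
    · simp [hk, hk.not_gt, (h k).2.2.2 hk]
    · simp [hk, hzero _ hk]
    · simp [hk, hk.not_gt, (h k).2.2.1 hk]
  obtain ⟨σ, hσ, hs⟩ := key h
  obtain ⟨τ, hτ, ht⟩ := key h'
  have heq : (fun i => max (ρ i) 0) ∘ σ = (fun i => max (ρ i) 0) ∘ τ :=
    Tuple.unique_monotone hσ hτ
  rw [hs, ht]
  congr 1
  refine Finset.sum_congr rfl fun k _ => ?_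
  congr 1
  have hk : max (ρ (σ k)) 0 = max (ρ (τ k)) 0 := congrFun heq k
  by_cases h1 : 0 < ρ (σ k)
  · rw [max_eq_left h1.le] at hk
    have h2 : 0 < ρ (τ k) := by
      by_contra! h2
      rw [max_eq_right h2] at hk
      omega
    rw [max_eq_left h2.le] at hk
    rw [if_pos h1, if_pos h2, hlevel _ _ h1 hk]
  · have h2 : ¬ 0 < ρ (τ k) := fun h2 => by
      rw [max_eq_right (not_lt.1 h1), max_eq_left h2.le] at hk
      omega
    rw [if_neg h1, if_neg h2]

lemma forall_mem_vectorSpan_optimalSet {f : Fin n → ℝ} :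
    (∀ w ∈ vectorSpan ℝ (optimalSet B ρ), ∑ i, f i * w i = 0) ↔
      ∀ β β' : Fin n → ℕ, IsOptimal B ρ β → IsOptimal B ρ β' →
        ∑ i, f i * (β i : ℝ) = ∑ i, f i * (β' i : ℝ) := by
  constructor
  · intro h β β' hβ hβ'
    have := h _ (vsub_mem_vectorSpan ℝ ⟨β, hβ, rfl⟩ ⟨β', hβ', rfl⟩)
    simp only [vsub_eq_sub, Pi.sub_apply, mul_sub, Finset.sum_sub_distrib] at this
    linarith
  · intro h w hw
    have hle : vectorSpan ℝ (optimalSet B ρ) ≤ LinearMap.ker (dotForm f).toLinearMap := by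
      refine Submodule.span_le.2 ?_
      rintro _ ⟨_, ⟨β, hβ, rfl⟩, _, ⟨β', hβ', rfl⟩, rfl⟩
      simp [dotForm_apply, mul_sub, h β β' hβ hβ']
    have := hle hw
    rwa [LinearMap.mem_ker, ContinuousLinearMap.coe_coe, dotForm_apply] at this

/-- The functionals that are constant on the optimal points of a reduced level map. -/
lemma IsReducedMap.forall_sum_eq_iff (hB : StrictMono B) (hpos : ∀ k, 0 < B k) (h : IsReducedMap B ρ)
    {f : Fin n → ℝ} :
    (∀ β β' : Fin n → ℕ, IsOptimal B ρ β → IsOptimal B ρ β' →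
        ∑ i, f i * (β i : ℝ) = ∑ i, f i * (β' i : ℝ)) ↔
      (∀ i, ρ i = 0 → f i = 0) ∧ ∀ i j, 0 < ρ i → ρ i = ρ j → f i = f j := by
  refine ⟨fun hf => ⟨fun i hi => ?_, fun i j hi hij => ?_⟩,
    fun hf β β' hβ hβ' => hβ.sum_eq hf.1 hf.2 hβ'⟩
  · obtain ⟨σ, hσ, h1⟩ := h.exists_sorting hB hpos hi
    -- Two optimal points differing only at `i`, where the entries are `1` and `B (σ.symm i) > 1`.
    have e1 := isOptimal_mk hpos hσ 1 fun k => ⟨Nat.one_pos, hpos k⟩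
    have e2 := isOptimal_mk hpos hσ (Function.update 1 (σ.symm i) (B (σ.symm i))) fun k => by
      by_cases hk : k = σ.symm i
      · subst hk; simpa using hpos _
      · simpa [hk] using Nat.succ_le_iff.2 (hpos k)
    have hsum := hf _ _ e2 e1
    rw [← sub_eq_zero, ← Finset.sum_sub_distrib, Fintype.sum_eq_single i] at hsum
    · simp only [hi, lt_irrefl, if_false, Function.update_self, Pi.one_apply, Nat.cast_one,
        mul_one] at hsum
      have h2 : (1 : ℝ) < B (σ.symm i) := by exact_mod_cast h1
      have h3 : f i * ((B (σ.symm i) : ℝ) - 1) = 0 := by linarith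
      rcases mul_eq_zero.1 h3 with h3 | h3
      · exact h3
      · linarith
    · intro j hj
      simp [hj]
  · by_cases hne : i = j
    · rw [hne]
    obtain ⟨β, hβ⟩ := exists_isOptimal hpos ρ
    -- Swapping two coordinates of one level preserves optimality, and their entries differ because
    -- `B` is injective.
    have hsum := hf _ _ hβ (hβ.comp_perm (π := Equiv.swap i j) fun x => by
      by_cases hx : x = i
      · simp [hx, hij]
      · by_cases hx' : x = j
        · simp [hx', hij]
        · rw [Equiv.swap_apply_of_ne_of_ne hx hx'])
    rw [← sub_eq_zero, ← Finset.sum_sub_distrib, Fintype.sum_eq_add i j hne] at hsum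
    · simp only [Function.comp, Equiv.swap_apply_left, Equiv.swap_apply_right] at hsum
      have h3 : (f i - f j) * ((β i : ℝ) - β j) = 0 := by linarith
      rcases mul_eq_zero.1 h3 with h3 | h3
      · linarith
      · exfalso
        obtain ⟨σ, -, hσ⟩ := hβ.apply_symm
        have h4 : β i = β j := by exact_mod_cast sub_eq_zero.1 h3
        rw [(hσ i).2 hi, (hσ j).2 (hij ▸ hi)] at h4
        exact hne (σ.symm.injective (hB.injective h4))
    · rintro x ⟨h1, h2⟩
      simp [Equiv.swap_apply_of_ne_of_ne h1 h2]

/-- The dimension of the face of a reduced level map. -/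
lemma IsReducedMap.finrank_vectorSpan (hB : StrictMono B) (hpos : ∀ k, 0 < B k)
    (h : IsReducedMap B ρ) {r : ℕ} (hρ : IsLevelMap r ρ) :
    Module.finrank ℝ (vectorSpan ℝ (optimalSet B ρ)) +
      ((Finset.univ.filter fun i => ρ i < 0).card + r) = n := by
  -- Each negative coordinate is a class by itself, each positive level is one class, and zeros go
  -- to `none`.
  let p : Fin n → Option ({i // ρ i < 0} ⊕ Fin r) := fun i =>
    if h1 : ρ i < 0 then some (Sum.inl ⟨i, h1⟩) else
      if h2 : 0 < ρ i then some (Sum.inr ⟨(ρ i - 1).toNat, by have := (hρ.1 i).2; omega⟩) else none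
  have hcard : Fintype.card ({i // ρ i < 0} ⊕ Fin r) =
      (Finset.univ.filter fun i => ρ i < 0).card + r := by
    rw [Fintype.card_sum, Fintype.card_fin, Fintype.card_subtype]
  rw [← hcard]
  refine finrank_add_card_of_annihilator p ?_ _ fun f => ?_
  · rintro (⟨i, hi⟩ | t)
    · exact ⟨i, by simp [p, hi]⟩
    · obtain ⟨i, hi⟩ := hρ.2 (t + 1) (by omega) (by have := t.2; omega)
      refine ⟨i, ?_⟩
      have h1 : ¬ ρ i < 0 := by omega
      have h2 : 0 < ρ i := by omega
      simp only [p, dif_neg h1, dif_pos h2, Option.some.injEq, Sum.inr.injEq, Fin.ext_iff]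
      omega
  · rw [forall_mem_vectorSpan_optimalSet, h.forall_sum_eq_iff hB hpos]
    have hnone : ∀ i, p i = none ↔ ρ i = 0 := fun i => by
      rcases lt_trichotomy (ρ i) 0 with hi | hi | hi
      · simp [p, hi, hi.ne]
      · simp [p, hi]
      · simp [p, hi, hi.ne', hi.not_gt]
    simp only [hnone]
    refine and_congr_right fun hzero => ⟨fun hf i j hij => ?_, fun hf i j hi hij => ?_⟩
    · rcases lt_trichotomy (ρ i) 0 with hi | hi | hi
      · rcases lt_trichotomy (ρ j) 0 with hj | hj | hj
        · simp only [p, dif_pos hi, dif_pos hj, Option.some.injEq, Sum.inl.injEq,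
            Subtype.mk.injEq] at hij
          rw [hij]
        · rw [(hnone j).2 hj, hnone] at hij
          omega
        · simp [p, hi, hj, hj.not_gt] at hij
      · have hj := hij
        rw [(hnone i).2 hi, eq_comm, hnone] at hj
        rw [hzero i hi, hzero j hj]
      · rcases lt_trichotomy (ρ j) 0 with hj | hj | hj
        · simp [p, hi, hj, hi.not_gt] at hij
        · rw [(hnone j).2 hj, hnone] at hij
          omega
        · simp only [p, dif_neg hi.not_gt, dif_pos hi, dif_neg hj.not_gt, dif_pos hj,
            Option.some.injEq, Sum.inr.injEq, Fin.mk.injEq] at hij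
          exact hf i j hi (by omega)
    · refine hf i j ?_
      have hj := hij ▸ hi
      simp only [p, dif_neg hi.not_gt, dif_neg hj.not_gt, dif_pos hj, hij]

end Dimension

/-! ### Counting level maps -/

/-- The number of coordinates where `ρ` is negative. -/
def negCard {n : ℕ} (ρ : Fin n → ℤ) : ℕ := (Finset.univ.filter fun i => ρ i < 0).card

/-- The number of coordinates where `ρ` is nonpositive. -/
def nonposCard {n : ℕ} (ρ : Fin n → ℤ) : ℕ := (Finset.univ.filter fun i => ρ i ≤ 0).card

/-- The maps with values in `K ∪ {-1, 0}` that attain all values in `K`, and attain `-1` exactly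
`j` times. -/
def levelFinset (n j : ℕ) (K : Finset ℤ) : Finset (Fin n → ℤ) :=
  (Fintype.piFinset fun _ : Fin n => insert (-1) (insert 0 K)).filter fun ρ =>
    (∀ t ∈ K, ∃ i, ρ i = t) ∧ negCard ρ = j

lemma mem_levelFinset {n j : ℕ} {K : Finset ℤ} {ρ : Fin n → ℤ} :
    ρ ∈ levelFinset n j K ↔ (∀ i, ρ i = -1 ∨ ρ i = 0 ∨ ρ i ∈ K) ∧ (∀ t ∈ K, ∃ i, ρ i = t) ∧
      negCard ρ = j := by
  simp [levelFinset]

lemma negCard_cons {n : ℕ} (v : ℤ) (ρ : Fin n → ℤ) :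
    negCard (Fin.cons v ρ : Fin (n + 1) → ℤ) = (if v < 0 then 1 else 0) + negCard ρ := by
  unfold negCard
  rw [Finset.card_filter, Finset.card_filter, Fin.sum_univ_succ]
  simp

lemma exists_cons_eq_iff {n : ℕ} {v t : ℤ} {ρ : Fin n → ℤ} :
    (∃ i, (Fin.cons v ρ : Fin (n + 1) → ℤ) i = t) ↔ v = t ∨ ∃ i, ρ i = t := by
  rw [Fin.exists_fin_succ]
  simp

lemma card_filter_apply_zero_eq {n : ℕ} (S : Finset (Fin (n + 1) → ℤ)) (v : ℤ)
    (T : Finset (Fin n → ℤ)) (hT : ∀ ρ, ρ ∈ T ↔ (Fin.cons v ρ : Fin (n + 1) → ℤ) ∈ S) :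
    (S.filter fun ρ => ρ 0 = v).card = T.card := by
  symm
  refine Finset.card_bij (fun ρ _ => (Fin.cons v ρ : Fin (n + 1) → ℤ)) ?_ ?_ ?_
  · intro ρ hρ
    rw [Finset.mem_filter, ← hT]
    exact ⟨hρ, rfl⟩
  · intro ρ _ ρ' _ h
    exact Fin.cons_right_injective (α := fun _ => ℤ) v h
  · intro ρ hρ
    rw [Finset.mem_filter] at hρ
    refine ⟨Fin.tail ρ, ?_, ?_⟩
    · rw [hT, ← hρ.2, Fin.cons_self_tail]
      exact hρ.1
    · rw [← hρ.2, Fin.cons_self_tail]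

section Count

variable {n j : ℕ} {K : Finset ℤ}

lemma cons_mem_levelFinset {v : ℤ} {ρ : Fin n → ℤ} :
    (Fin.cons v ρ : Fin (n + 1) → ℤ) ∈ levelFinset (n + 1) j K ↔
      (v = -1 ∨ v = 0 ∨ v ∈ K) ∧ (∀ i, ρ i = -1 ∨ ρ i = 0 ∨ ρ i ∈ K) ∧
      (∀ t ∈ K, v = t ∨ ∃ i, ρ i = t) ∧ (if v < 0 then 1 else 0) + negCard ρ = j := by
  rw [mem_levelFinset, Fin.forall_fin_succ, negCard_cons]
  simp only [exists_cons_eq_iff, Fin.cons_zero, Fin.cons_succ, and_assoc]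

lemma cons_zero_mem_levelFinset (hK : ∀ t ∈ K, 0 < t) {ρ : Fin n → ℤ} :
    (Fin.cons 0 ρ : Fin (n + 1) → ℤ) ∈ levelFinset (n + 1) j K ↔ ρ ∈ levelFinset n j K := by
  rw [cons_mem_levelFinset, mem_levelFinset]
  have : ∀ t ∈ K, (0 = t ∨ ∃ i, ρ i = t) ↔ ∃ i, ρ i = t := fun t ht =>
    or_iff_right (hK t ht).ne
  simp +contextual [this]

lemma cons_neg_one_mem_levelFinset (hK : ∀ t ∈ K, 0 < t) {ρ : Fin n → ℤ} :
    (Fin.cons (-1) ρ : Fin (n + 1) → ℤ) ∈ levelFinset (n + 1) j K ↔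
      1 ≤ j ∧ ρ ∈ levelFinset n (j - 1) K := by
  rw [cons_mem_levelFinset, mem_levelFinset]
  have h1 : (∀ t ∈ K, (-1 = t ∨ ∃ i, ρ i = t)) ↔ ∀ t ∈ K, ∃ i, ρ i = t :=
    forall₂_congr fun t ht => or_iff_right (by have := hK t ht; omega)
  have h2 : (if (-1 : ℤ) < 0 then 1 else 0) + negCard ρ = j ↔ 1 ≤ j ∧ negCard ρ = j - 1 := by
    rw [if_pos (by norm_num)]
    omega
  rw [h1, h2]
  tauto

/-- The value `v` either recurs in the tail or does not. The second case deletes `v` from the value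
set, which is why `K` is an arbitrary finite set and not an interval. -/
lemma cons_pos_mem_levelFinset (hK : ∀ t ∈ K, 0 < t) {v : ℤ} (hv : v ∈ K) {ρ : Fin n → ℤ} :
    (Fin.cons v ρ : Fin (n + 1) → ℤ) ∈ levelFinset (n + 1) j K ↔
      ρ ∈ levelFinset n j K ∪ levelFinset n j (K.erase v) := by
  rw [cons_mem_levelFinset, Finset.mem_union, mem_levelFinset, mem_levelFinset,
    if_neg (hK v hv).not_gt, zero_add]
  constructor
  · rintro ⟨-, h1, h2, h3⟩
    by_cases hex : ∃ i, ρ i = v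
    · refine Or.inl ⟨h1, fun t ht => ?_, h3⟩
      rcases h2 t ht with rfl | h
      · exact hex
      · exact h
    · refine Or.inr ⟨fun i => ?_, fun t ht => ?_, h3⟩
      · rcases h1 i with h | h | h
        · exact Or.inl h
        · exact Or.inr (Or.inl h)
        · exact Or.inr (Or.inr (Finset.mem_erase.2 ⟨fun h => hex ⟨i, h⟩, h⟩))
      · rw [Finset.mem_erase] at ht
        exact (h2 t ht.2).resolve_left ht.1.symm
  · rintro (⟨h1, h2, h3⟩ | ⟨h1, h2, h3⟩)
    · exact ⟨Or.inr (Or.inr hv), h1, fun t ht => Or.inr (h2 t ht), h3⟩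
    · refine ⟨Or.inr (Or.inr hv), fun i => ?_, fun t ht => ?_, h3⟩
      · rcases h1 i with h | h | h
        · exact Or.inl h
        · exact Or.inr (Or.inl h)
        · exact Or.inr (Or.inr (Finset.mem_of_mem_erase h))
      · by_cases htv : v = t
        · exact Or.inl htv
        · exact Or.inr (h2 t (Finset.mem_erase.2 ⟨Ne.symm htv, ht⟩))

lemma disjoint_levelFinset_erase (hK : ∀ t ∈ K, 0 < t) {v : ℤ} (hv : v ∈ K) :
    Disjoint (levelFinset n j K) (levelFinset n j (K.erase v)) := by
  rw [Finset.disjoint_left]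
  intro ρ h h'
  rw [mem_levelFinset] at h h'
  obtain ⟨i, hi⟩ := h.2.1 v hv
  have hpos := hK v hv
  rcases h'.1 i with h1 | h1 | h1
  · omega
  · omega
  · exact (Finset.mem_erase.1 h1).1 hi

lemma card_levelFinset_succ (hK : ∀ t ∈ K, 0 < t) :
    (levelFinset (n + 1) j K).card =
      (if 1 ≤ j then (levelFinset n (j - 1) K).card else 0) + ((levelFinset n j K).card +
        ∑ v ∈ K, ((levelFinset n j K).card + (levelFinset n j (K.erase v)).card)) := by
  have h0 : (0 : ℤ) ∉ K := fun h => lt_irrefl _ (hK 0 h)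
  have h1 : (-1 : ℤ) ∉ insert 0 K := fun h => by
    rcases Finset.mem_insert.1 h with h | h
    · omega
    · have := hK _ h; omega
  rw [Finset.card_eq_sum_card_fiberwise (f := fun ρ => ρ 0) (t := insert (-1) (insert 0 K)),
    Finset.sum_insert h1, Finset.sum_insert h0]
  · congr 1
    · rw [card_filter_apply_zero_eq _ _ (if 1 ≤ j then levelFinset n (j - 1) K else ∅)]
      · split_ifs <;> simp
      · intro ρ
        rw [cons_neg_one_mem_levelFinset hK]
        split_ifs with h <;> simp [h]
    · congr 1
      · exact card_filter_apply_zero_eq _ _ _ fun ρ => (cons_zero_mem_levelFinset hK).symm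
      · refine Finset.sum_congr rfl fun v hv => ?_
        rw [card_filter_apply_zero_eq _ _ _ fun ρ => (cons_pos_mem_levelFinset hK hv).symm,
          Finset.card_union_of_disjoint (disjoint_levelFinset_erase hK hv)]
  · intro ρ hρ
    simpa using (mem_levelFinset.1 hρ).1 0

end Count

/-- The Stirling recurrence in the shape of the recursion for level maps. At `r = 0` the truncated
`r - 1` is harmless because of the factor `r`. -/
lemma factorial_mul_stirlingSecond_succ (m r : ℕ) :
    r.factorial * Nat.stirlingSecond (m + 2) (r + 1) =
      r.factorial * Nat.stirlingSecond (m + 1) (r + 1) +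
        r * (r.factorial * Nat.stirlingSecond (m + 1) (r + 1) +
          (r - 1).factorial * Nat.stirlingSecond (m + 1) (r - 1 + 1)) := by
  rw [Nat.stirlingSecond_succ_succ]
  cases r with
  | zero => simp [Nat.stirlingSecond_succ_zero]
  | succ r =>
    rw [Nat.add_sub_cancel, Nat.factorial_succ]
    ring

/-- Choose the negative coordinates, then partition the other `n - j` together with one extra point
into `K.card + 1` blocks. The block of the extra point gives the zeros, possibly none; the rest are
labelled by `K`. The proof matches recursions on the first coordinate. -/
lemma card_levelFinset (n : ℕ) : ∀ (j : ℕ) (K : Finset ℤ), (∀ t ∈ K, 0 < t) →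
    (levelFinset n j K).card =
      n.choose j * (K.card.factorial * Nat.stirlingSecond (n - j + 1) (K.card + 1)) := by
  induction n with
  | zero =>
    intro j K _
    have hneg : ∀ ρ : Fin 0 → ℤ, negCard ρ = 0 := fun ρ => by simp [negCard]
    by_cases h : K = ∅ ∧ j = 0
    · obtain ⟨rfl, rfl⟩ := h
      have : levelFinset 0 0 ∅ = Finset.univ := by
        ext ρ
        simp only [mem_levelFinset, hneg, IsEmpty.forall_iff, Finset.notMem_empty, implies_true,
          and_self, Finset.mem_univ]
      rw [this]
      simp [Nat.stirlingSecond_one_right]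
    · have : levelFinset 0 j K = ∅ := by
        refine Finset.eq_empty_of_forall_notMem fun ρ hρ => h ?_
        rw [mem_levelFinset, hneg] at hρ
        refine ⟨Finset.eq_empty_of_forall_notMem fun t ht => ?_, hρ.2.2.symm⟩
        obtain ⟨i, -⟩ := hρ.2.1 t ht
        exact i.elim0
      rw [this, Finset.card_empty]
      by_cases hj : j = 0
      · subst hj
        have hK : K.card ≠ 0 := fun hK => h ⟨Finset.card_eq_zero.1 hK, rfl⟩
        rw [Nat.stirlingSecond_eq_zero_of_lt (by omega)]
        simp
      · rw [Nat.choose_eq_zero_of_lt (Nat.pos_of_ne_zero hj), zero_mul]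
  | succ n ih =>
    intro j K hK
    have herase : ∀ v ∈ K, (levelFinset n j (K.erase v)).card = n.choose j *
        ((K.card - 1).factorial * Nat.stirlingSecond (n - j + 1) (K.card - 1 + 1)) :=
      fun v hv => by
        rw [ih j _ fun t ht => hK t (Finset.mem_of_mem_erase ht), Finset.card_erase_of_mem hv]
    rw [card_levelFinset_succ hK, Finset.sum_congr rfl fun v hv => by rw [herase v hv],
      Finset.sum_const, smul_eq_mul, ih j K hK]
    cases j with
    | zero =>
      have := factorial_mul_stirlingSecond_succ n K.card
      simp only [Nat.choose_zero_right, Nat.sub_zero, one_mul]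
      rw [if_neg (by omega), zero_add]
      exact this.symm
    | succ j =>
      rw [if_pos (by omega), Nat.add_sub_cancel, ih j K hK, Nat.choose_succ_succ,
        Nat.add_sub_add_right]
      by_cases hj : j + 1 ≤ n
      · have := factorial_mul_stirlingSecond_succ (n - (j + 1)) K.card
        have h1 : n - (j + 1) + 2 = n - j + 1 := by omega
        rw [h1] at this
        rw [add_mul, Nat.succ_eq_add_one, this]
        ring
      · rw [Nat.succ_eq_add_one, Nat.choose_eq_zero_of_lt (by omega : n < j + 1)]
        simp

lemma mem_levelFinset_Icc {n j r : ℕ} {ρ : Fin n → ℤ} :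
    ρ ∈ levelFinset n j (Finset.Icc 1 (r : ℤ)) ↔ IsLevelMap r ρ ∧ negCard ρ = j := by
  rw [mem_levelFinset, IsLevelMap, and_assoc]
  simp only [Finset.mem_Icc, and_imp]
  refine and_congr (forall_congr' fun i => ?_) Iff.rfl
  constructor
  · intro h; omega
  · intro h; omega

/-- The level maps whose face has formal dimension `k`. -/
def levelMaps (n k : ℕ) : Set (Fin n → ℤ) :=
  {ρ | ∃ r, IsLevelMap r ρ ∧ negCard ρ + r + k = n}

/-- Once the number `j` of negative coordinates is fixed, the number of levels must be `n - k - j`.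
-/
lemma encard_levelMaps_filter {n k : ℕ} (hk : k ≤ n) (p : ℕ → Prop) [DecidablePred p] :
    {ρ ∈ levelMaps n k | p (negCard ρ)}.encard =
      ((∑ j ∈ (Finset.range (n - k + 1)).filter p, n.choose j * (n - k - j).factorial *
        Nat.stirlingSecond (n - j + 1) (n - k - j + 1) : ℕ) : ℕ∞) := by
  have heq : {ρ ∈ levelMaps n k | p (negCard ρ)} =
      (((Finset.range (n - k + 1)).filter p).biUnion fun j =>
        levelFinset n j (Finset.Icc 1 ((n - k - j : ℕ) : ℤ)) : Finset (Fin n → ℤ)) := by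
    ext ρ
    simp only [Set.mem_ofPred_eq, Finset.mem_coe, Finset.mem_biUnion, Finset.mem_filter,
      Finset.mem_range, mem_levelFinset_Icc, levelMaps]
    constructor
    · rintro ⟨⟨r, hr, hrk⟩, hp⟩
      refine ⟨negCard ρ, ⟨by omega, hp⟩, ?_, rfl⟩
      rwa [show n - k - negCard ρ = r by omega]
    · rintro ⟨j, ⟨hj, hp⟩, hr, rfl⟩
      exact ⟨⟨_, hr, by omega⟩, hp⟩
  rw [heq, Set.encard_coe_eq_coe_finsetCard, Finset.card_biUnion]
  · congr 1
    refine Finset.sum_congr rfl fun j _ => ?_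
    rw [card_levelFinset n j _ fun t ht => by rw [Finset.mem_Icc] at ht; omega, Int.card_Icc]
    rw [show ((n - k - j : ℕ) + 1 - 1 : ℤ).toNat = n - k - j by omega]
    ring
  · intro i _ j _ hij
    rw [Function.onFun, Finset.disjoint_left]
    intro ρ h1 h2
    rw [mem_levelFinset] at h1 h2
    exact hij (h1.2.2.symm.trans h2.2.2)

/-! ### Exchanging the two exclusion conditions -/

section Shift

variable {n k : ℕ} {ρ : Fin n → ℤ}

lemma negCard_sub_one : negCard (fun i => ρ i - 1) = nonposCard ρ := by
  unfold negCard nonposCard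
  congr 1
  ext i
  simp only [Finset.mem_filter, Finset.mem_univ, true_and]
  omega

lemma nonposCard_add_one : nonposCard (fun i => ρ i + 1) = negCard ρ := by
  unfold negCard nonposCard
  congr 1

lemma negCard_le_nonposCard : negCard ρ ≤ nonposCard ρ :=
  Finset.card_le_card fun i hi => by
    simp only [Finset.mem_filter, Finset.mem_univ, true_and] at hi ⊢
    omega

lemma exists_eq_zero_of_card_ne (h : nonposCard ρ ≠ negCard ρ) : ∃ i, ρ i = 0 := by
  by_contra! hne
  refine h (congrArg Finset.card ?_)
  ext i
  simp only [Finset.mem_filter, Finset.mem_univ, true_and]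
  have := hne i
  omega

/-- The shift trades the one negative coordinate for one more level, the former zeros, so the formal
dimension is unchanged. -/
lemma add_one_mem_levelMaps (hρ : ρ ∈ levelMaps n k) (hneg : negCard ρ = 1)
    (hnp : nonposCard ρ ≠ 1) :
    (fun i => ρ i + 1) ∈ levelMaps n k ∧ negCard (fun i => ρ i + 1) ≠ 1 := by
  obtain ⟨r, hr, hrk⟩ := hρ
  have h0 : negCard (fun i => ρ i + 1) = 0 := by
    refine Finset.card_eq_zero.2 (Finset.filter_false_of_mem fun i _ => ?_)
    have := (hr.1 i).1
    beta_reduce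
    omega
  refine ⟨⟨r + 1, ⟨fun i => ?_, fun t h1 h2 => ?_⟩, by omega⟩, by omega⟩
  · have := hr.1 i
    push_cast
    constructor <;> omega
  · push_cast at h2
    rcases h1.eq_or_lt with rfl | h1
    · obtain ⟨i, hi⟩ := exists_eq_zero_of_card_ne (ρ := ρ) (by omega)
      exact ⟨i, by beta_reduce; omega⟩
    · obtain ⟨i, hi⟩ := hr.2 (t - 1) (by omega) (by omega)
      exact ⟨i, by beta_reduce; omega⟩

lemma sub_one_mem_levelMaps (hn : n ≠ 1) (hρ : ρ ∈ levelMaps n k) (hneg : negCard ρ ≠ 1)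
    (hnp : nonposCard ρ = 1) :
    (fun i => ρ i - 1) ∈ levelMaps n k ∧ nonposCard (fun i => ρ i - 1) ≠ 1 := by
  obtain ⟨r, hr, hrk⟩ := hρ
  have hle := negCard_le_nonposCard (ρ := ρ)
  have h0 : negCard ρ = 0 := by omega
  -- A level must exist to become the new zeros. With `r = 0` every coordinate would be nonpositive,
  -- forcing `n = 1`.
  have hr0 : r ≠ 0 := by
    rintro rfl
    have : nonposCard ρ = n := by
      unfold nonposCard
      rw [Finset.filter_true_of_mem fun i _ => by have := (hr.1 i).2; simpa using this]
      simp
    omega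
  have hnonneg : ∀ i, 0 ≤ ρ i := fun i => by
    have := Finset.card_eq_zero.1 h0
    rw [Finset.filter_eq_empty_iff] at this
    exact not_lt.1 (this (Finset.mem_univ i))
  refine ⟨⟨r - 1, ⟨fun i => ?_, fun t h1 h2 => ?_⟩, ?_⟩, fun h => ?_⟩
  · have := hr.1 i
    have := hnonneg i
    beta_reduce
    constructor <;> omega
  · obtain ⟨i, hi⟩ := hr.2 (t + 1) (by omega) (by omega)
    exact ⟨i, by beta_reduce; omega⟩
  · rw [negCard_sub_one]
    omega
  · obtain ⟨i, hi⟩ := hr.2 1 le_rfl (by omega)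
    have hlt : nonposCard ρ < nonposCard (fun i => ρ i - 1) := by
      refine Finset.card_lt_card ((Finset.ssubset_iff_of_subset fun j hj => ?_).2 ⟨i, ?_, ?_⟩)
      · simp only [Finset.mem_filter, Finset.mem_univ, true_and] at hj ⊢
        omega
      · simp [hi]
      · simp [hi]
    omega

/-- Shifting by one exchanges the maps with one negative and some zero value and the maps with one
zero and no negative value. -/
lemma encard_levelMaps_nonposCard_ne_one (hn : n ≠ 1) :
    {ρ ∈ levelMaps n k | nonposCard ρ ≠ 1}.encard =
      {ρ ∈ levelMaps n k | negCard ρ ≠ 1}.encard := by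
  let g : (Fin n → ℤ) → Fin n → ℤ := fun ρ => if negCard ρ = 1 then fun i => ρ i + 1 else ρ
  let h : (Fin n → ℤ) → Fin n → ℤ := fun ρ => if nonposCard ρ = 1 then fun i => ρ i - 1 else ρ
  have hbij : Set.BijOn g {ρ ∈ levelMaps n k | nonposCard ρ ≠ 1}
      {ρ ∈ levelMaps n k | negCard ρ ≠ 1} := by
    refine Set.InvOn.bijOn (f' := h) ⟨?_, ?_⟩ ?_ ?_
    · rintro ρ ⟨hρ, hnp⟩
      by_cases hneg : negCard ρ = 1
      · simp [g, h, hneg, nonposCard_add_one]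
      · simp [g, h, hneg, hnp]
    · rintro ρ ⟨hρ, hneg⟩
      by_cases hnp : nonposCard ρ = 1
      · simp [g, h, hnp, negCard_sub_one]
      · simp [g, h, hneg, hnp]
    · rintro ρ ⟨hρ, hnp⟩
      by_cases hneg : negCard ρ = 1
      · simp only [g, if_pos hneg]
        exact add_one_mem_levelMaps hρ hneg hnp
      · simp only [g, if_neg hneg]
        exact ⟨hρ, hneg⟩
    · rintro ρ ⟨hρ, hneg⟩
      by_cases hnp : nonposCard ρ = 1
      · simp only [h, if_pos hnp]
        exact sub_one_mem_levelMaps hn hρ hneg hnp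
      · simp only [h, if_neg hnp]
        exact ⟨hρ, hnp⟩
  rw [← hbij.image_eq, hbij.injOn.encard_image]

end Shift

/-! ### The face numbers -/

/-- The faces of the parking polytope correspond to the reduced level maps. -/
lemma faceNumber_parkingPolytope {n : ℕ} {b : Fin n → ℕ} (hb : ∀ i, 0 < b i) (k : ℕ) :
    faceNumber (parkingPolytope b) k =
      {ρ ∈ levelMaps n k | IsReducedMap (prefixSum b) ρ}.encard := by
  have hB := prefixSum_strictMono hb
  have hpos := prefixSum_pos hb
  have hinj : Set.InjOn (fun ρ : Fin n → ℤ => convexHull ℝ (optimalSet (prefixSum b) ρ))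
      {ρ ∈ levelMaps n k | IsReducedMap (prefixSum b) ρ} := by
    rintro ρ ⟨⟨r, hr, -⟩, hred⟩ ρ' ⟨⟨r', hr', -⟩, hred'⟩ heq
    exact hr.eq_of_isOptimal_iff hB hpos hr' hred hred' fun β =>
      isOptimal_iff_of_convexHull_eq hb heq
  rw [faceNumber, ← hinj.encard_image]
  congr 1
  ext F
  rw [mem_facesOfDim_iff hb]
  constructor
  · rintro ⟨c, rfl, hk⟩
    obtain ⟨r₀, ρ₀, hρ₀, hneg, hpos', hle⟩ := exists_isLevelMap c
    obtain ⟨r, ρ, hρ, hred, hopt⟩ := hρ₀.exists_isReduced hB hpos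
    have heq : optimalSet (prefixSum b) c = optimalSet (prefixSum b) ρ := by
      simp only [optimalSet, isOptimal_congr hneg hpos' hle, hopt]
    rw [heq] at hk
    have hdim := hred.finrank_vectorSpan hB hpos hρ
    refine ⟨ρ, ⟨⟨r, hρ, ?_⟩, hred⟩, by rw [heq]⟩
    unfold negCard
    omega
  · rintro ⟨ρ, ⟨⟨r, hρ, hrk⟩, hred⟩, rfl⟩
    have hdim := hred.finrank_vectorSpan hB hpos hρ
    refine ⟨fun i => (ρ i : ℝ), by rw [optimalSet_intCast], ?_⟩
    rw [optimalSet_intCast]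
    unfold negCard at hrk
    omega

theorem mainTheorem6 (n : ℕ) (hn : 0 < n) (b : Fin n → ℕ) (hb : ∀ i, 0 < b i)
    (hdeg : ¬ (n = 1 ∧ b ⟨0, hn⟩ = 1)) (k : ℕ) (hk : k ≤ n) :
    (b ⟨0, hn⟩ = 1 →
      faceNumber (parkingPolytope b) k =
        ((∑ j ∈ (Finset.range (n - k + 1)).filter (fun j => j ≠ 1),
          n.choose j * (n - k - j).factorial *
            Nat.stirlingSecond (n - j + 1) (n - k - j + 1) : ℕ) : ℕ∞)) ∧
    (2 ≤ b ⟨0, hn⟩ →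
      faceNumber (parkingPolytope b) k =
        ((∑ j ∈ Finset.range (n - k + 1),
          n.choose j * (n - k - j).factorial *
            Nat.stirlingSecond (n - j + 1) (n - k - j + 1) : ℕ) : ℕ∞)) := by
  -- Reducedness is a genuine restriction exactly when `b_1 = 1`; for `b_1 ≥ 2` every level map
  -- counts.
  have hone : (∃ l, prefixSum b l = 1) ↔ b ⟨0, hn⟩ = 1 := by
    rw [← prefixSum_zero hn b]
    refine ⟨?_, fun h => ⟨_, h⟩⟩
    rintro ⟨l, hl⟩
    have h1 := (prefixSum_strictMono hb).monotone (show (⟨0, hn⟩ : Fin n) ≤ l from Nat.zero_le _)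
    have h2 := prefixSum_pos hb ⟨0, hn⟩
    omega
  refine ⟨fun h => ?_, fun h => ?_⟩
  · have hn1 : n ≠ 1 := fun h' => hdeg ⟨h', h⟩
    rw [faceNumber_parkingPolytope hb, ← encard_levelMaps_filter hk,
      ← encard_levelMaps_nonposCard_ne_one hn1]
    simp only [IsReducedMap, hone, h, forall_const, nonposCard]
  · have h1 := encard_levelMaps_filter hk fun _ => True
    rw [Finset.filter_true] at h1
    rw [faceNumber_parkingPolytope hb, ← h1]
    simp only [IsReducedMap, hone, show b ⟨0, hn⟩ ≠ 1 by omega, IsEmpty.forall_iff]
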